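/- For $X,Y\in \mathrm{PSL}(2,\mathbb C)$ put $J(X,Y)=|\operatorname{tr}^2X-4|+|\operatorname{tr}[X,Y]-2|$, where $[X,Y]=XYX^{-1}Y^{-1}$ (this does not depend on the chosen lifts to $\mathrm{SL}(2,\mathbb C)$), and for a rank two non-elementary discrete subgroup $G\le \mathrm{PSL}(2,\mathbb C)$ let $$J(G)=\inf\{J(X,Y) : X,Y\in \mathrm{PSL}(2,\mathbb C),\ \langle X,Y\rangle=G\}$$ be its Jørgensen number. For $0<\theta\le\pi/4$ let $\rho_\theta:F_2=\langle A,B\rangle\to\mathrm{SL}(2,\mathbb C)$ be the representation of the free group on $A,B$ given by $$\rho_\theta(A)=\frac1{\sin\theta}\begin{pmatrix}1& i\cos\theta\\ -i\cos\theta&1\end{pmatrix},\qquad \rho_\theta(B)=\frac1{\sin\theta}\begin{pmatrix}1&\cos\theta\\ \cos\theta&1\end{pmatrix},$$ and write $\rho_\theta(F_2)$ also for the image of this group in $\mathrm{PSL}(2,\mathbb C)$. **Proposition.** For every $\theta$ with $0<\theta\le\pi/4$, the group $\rho_\theta(F_2)\le\mathrm{PSL}(2,\mathbb C)$ is discrete,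 non-elementary (it has no finite orbit in $\mathbb H^3\cup\partial\mathbb H^3$) and of rank two (its minimal number of generators is $2$), and $$J(\rho_\theta(F_2))=J(\rho_\theta(A),\rho_\theta(B))=\frac{4\cos^2\theta}{\sin^4\theta}.$$ In particular $J(\rho_{\pi/4}(F_2))=8$ and $\lim_{\theta\to0^+}J(\rho_\theta(F_2))=\infty$, and for every real $r\ge 8$ there is $\theta\in(0,\pi/4]$ with $J(\rho_\theta(F_2))=r$. -/

import Mathlib

open scoped MatrixGroups ComplexOrder

noncomputable section

namespace Jorgensen

/-- The class in `PSL(2, ℂ)` of a matrix in `SL(2, ℂ)`. -/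
def toPSL : SL(2, ℂ) →* PSL(2, ℂ) :=
  QuotientGroup.mk' (Subgroup.center SL(2, ℂ))

/-- `|tr² X - 4| + |tr [X, Y] - 2|` for matrices, with `[X, Y] = X Y X⁻¹ Y⁻¹`. -/
def pairNumberSL (X Y : SL(2, ℂ)) : ℝ :=
  ‖(X : Matrix (Fin 2) (Fin 2) ℂ).trace ^ 2 - 4‖ +
    ‖((X * Y * X⁻¹ * Y⁻¹ : SL(2, ℂ)) : Matrix (Fin 2) (Fin 2) ℂ).trace - 2‖

theorem pairNumberSL_mul_center (X Y Z W : SL(2, ℂ))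
    (hZ : Z ∈ Subgroup.center SL(2, ℂ)) (hW : W ∈ Subgroup.center SL(2, ℂ)) :
    pairNumberSL (X * Z) (Y * W) = pairNumberSL X Y := by
  have h1 : X * Z * (Y * W) * (X * Z)⁻¹ * (Y * W)⁻¹ = X * Y * X⁻¹ * Y⁻¹ := by
    have hZ' := Subgroup.mem_center_iff.mp hZ
    have hW' := Subgroup.mem_center_iff.mp hW
    calc X * Z * (Y * W) * (X * Z)⁻¹ * (Y * W)⁻¹
        = X * (Z * (Y * W)) * Z⁻¹ * X⁻¹ * W⁻¹ * Y⁻¹ := by group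
      _ = X * (Y * W * Z) * Z⁻¹ * X⁻¹ * W⁻¹ * Y⁻¹ := by rw [hZ' (Y * W)]
      _ = X * Y * (W * X⁻¹) * W⁻¹ * Y⁻¹ := by group
      _ = X * Y * (X⁻¹ * W) * W⁻¹ * Y⁻¹ := by rw [hW' X⁻¹]
      _ = X * Y * X⁻¹ * Y⁻¹ := by group
  obtain ⟨r, hr, hrZ⟩ := Matrix.SpecialLinearGroup.mem_center_iff.mp hZ
  have h2 : ((X * Z : SL(2, ℂ)) : Matrix (Fin 2) (Fin 2) ℂ).trace ^ 2
      = (X : Matrix (Fin 2) (Fin 2) ℂ).trace ^ 2 := by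
    have hr2 : r ^ 2 = 1 := by simpa using hr
    have ht : ((X * Z : SL(2, ℂ)) : Matrix (Fin 2) (Fin 2) ℂ).trace
        = (X : Matrix (Fin 2) (Fin 2) ℂ).trace * r := by
      rw [Matrix.SpecialLinearGroup.coe_mul, ← hrZ]
      simp [Matrix.trace_fin_two, add_mul]
    rw [ht, mul_pow, hr2, mul_one]
  rw [pairNumberSL, pairNumberSL, h1, h2]

/-- The Jørgensen number `J(X, Y)` of an ordered pair in `PSL(2, ℂ)`, computed on any lifts. -/
def pairNumber (X Y : PSL(2, ℂ)) : ℝ :=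
  Quotient.liftOn₂' X Y pairNumberSL fun X₁ Y₁ X₂ Y₂ hX hY => by
    rw [QuotientGroup.leftRel_apply] at hX hY
    have h := pairNumberSL_mul_center X₁ Y₁ _ _ hX hY
    simpa using h.symm

theorem pairNumber_toPSL (X Y : SL(2, ℂ)) :
    pairNumber (toPSL X) (toPSL Y) = pairNumberSL X Y := rfl

/-- The Jørgensen number `J(G)`: the infimum of `J(X, Y)` over the ordered generating pairs. -/
def number (G : Subgroup PSL(2, ℂ)) : ℝ :=
  sInf {t : ℝ | ∃ X Y : PSL(2, ℂ), Subgroup.closure {X, Y} = G ∧ t = pairNumber X Y}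

/-- The minimal number of generators of `G` is two. -/
def HasRankTwo (G : Subgroup PSL(2, ℂ)) : Prop :=
  ∃ _ : Group.FG G, Group.rank G = 2

/-- `G` is non-elementary: it has no finite orbit in hyperbolic 3-space together with its boundary.
Hyperbolic 3-space is the set of positive definite Hermitian matrices `P` of determinant one,
on which `g` acts by `P ↦ g P gᴴ`; its boundary is the Riemann sphere, with Möbius maps. -/
def NonElementary (G : Subgroup PSL(2, ℂ)) : Prop :=
  (∀ P : Matrix (Fin 2) (Fin 2) ℂ, P.PosDef → P.det = 1 →
    {Q : Matrix (Fin 2) (Fin 2) ℂ | ∃ g : SL(2, ℂ), toPSL g ∈ G ∧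
      Q = (g : Matrix (Fin 2) (Fin 2) ℂ) * P *
        (g : Matrix (Fin 2) (Fin 2) ℂ).conjTranspose}.Infinite) ∧
  (∀ z : OnePoint ℂ,
    {w : OnePoint ℂ | ∃ g : SL(2, ℂ), toPSL g ∈ G ∧ w = (g : GL (Fin 2) ℂ) • z}.Infinite)

/-- The parameter range `0 < θ ≤ π / 4`. -/
abbrev Angle : Type := Set.Ioc (0 : ℝ) (Real.pi / 4)

theorem sin_ne_zero (θ : Angle) : Complex.sin ((θ : ℝ) : ℂ) ≠ 0 := by
  have h : 0 < Real.sin θ := Real.sin_pos_of_pos_of_lt_pi θ.2.1 (by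
    have := θ.2.2
    have := Real.pi_pos
    linarith)
  exact_mod_cast h.ne'

/-- `ρ_θ(A)`. -/
def matA (θ : Angle) : SL(2, ℂ) :=
  ⟨(1 / Complex.sin (θ : ℝ)) •
    !![1, Complex.I * Complex.cos (θ : ℝ); -Complex.I * Complex.cos (θ : ℝ), 1], by
    have h := sin_ne_zero θ
    have h2 := Complex.sin_sq_add_cos_sq ((θ : ℝ) : ℂ)
    rw [Matrix.det_smul, Matrix.det_fin_two_of]
    simp only [Fintype.card_fin]
    field_simp
    linear_combination (Complex.cos ((θ : ℝ) : ℂ)) ^ 2 * Complex.I_sq - h2⟩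

/-- `ρ_θ(B)`. -/
def matB (θ : Angle) : SL(2, ℂ) :=
  ⟨(1 / Complex.sin (θ : ℝ)) •
    !![1, Complex.cos (θ : ℝ); Complex.cos (θ : ℝ), 1], by
    have h := sin_ne_zero θ
    have h2 := Complex.sin_sq_add_cos_sq ((θ : ℝ) : ℂ)
    rw [Matrix.det_smul, Matrix.det_fin_two_of]
    simp only [Fintype.card_fin]
    field_simp
    linear_combination -h2⟩

/-- The free group `F₂` on `A = genA` and `B = genB`. -/
abbrev F₂ : Type := FreeGroup (Fin 2)

/-- The free generator `A` of `F₂`. -/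
def genA : F₂ := FreeGroup.of 0

/-- The free generator `B` of `F₂`. -/
def genB : F₂ := FreeGroup.of 1

/-- The `θ`-Schottky representation `ρ_θ` of `F₂` in `SL(2, ℂ)`. -/
def rho (θ : Angle) : F₂ →* SL(2, ℂ) :=
  FreeGroup.lift ![matA θ, matB θ]

/-- The `θ`-Schottky group: the image `ρ_θ(F₂)` in `PSL(2, ℂ)`. -/
def schottkyGroup (θ : Angle) : Subgroup PSL(2, ℂ) :=
  (toPSL.comp (rho θ)).range

end Jorgensen

end

/-! Put `t = 1 / sin θ`. All `ρ_θ` specialise one representation of `F₂` in the quaternion algebra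
over `ℤ[X]` with `i² = j² = X² - 1`, sending `A, B` to `X + i, X + j`; half traces become integer
polynomials evaluated at `t`. For a generating pair `x, y` of `F₂`, the order spanned by `1, x, y,
xy` contains the images of `A` and `B`, which forces the commutator norm to be `4(X² - 1)²`
(`qnorm_commutator_of_closure_eq_top`). Hence the half traces `P, Q, R` of `x, y, xy` satisfy a
Markov type equation, and the commutator term of `J` is the same for all generating pairs.

Vieta descent on degrees (`le_abs_eval_of_sorted`) ends at `(±X, ±X, ±X²)` and yields `|P(t)| ≥ t`,
so `tr²` is smallest at `A`, and `J = 4(t² - 1) + 4(t² - 1)²`.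

Ping-pong on the hyperbolic plane preserved by the group (`exists_hermMat_of_isReduced`) gives
discreteness and injectivity; by injectivity generating pairs of the group are exactly images of
generating pairs of `F₂`. -/

namespace Jorgensen

/-! ### Markov type triples of polynomials and Vieta descent -/

open Polynomial

/-- Triples of polynomials solving the Markov type equation
`P² + Q² + R² - 2PQR = 1 - (X² - 1)²`, with values `±1` at `±1`. -/
structure MarkovTriple (P Q R : ℤ[X]) : Prop where
  eqn : P ^ 2 + Q ^ 2 + R ^ 2 - 2 * P * Q * R = 1 - (X ^ 2 - 1) ^ 2
  fst_one : P.eval 1 ^ 2 = 1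
  fst_neg_one : P.eval (-1) ^ 2 = 1
  snd_one : Q.eval 1 ^ 2 = 1
  snd_neg_one : Q.eval (-1) ^ 2 = 1
  trd_one : R.eval 1 ^ 2 = 1
  trd_neg_one : R.eval (-1) ^ 2 = 1

namespace MarkovTriple

variable {P Q R : ℤ[X]}

theorem swap (h : MarkovTriple P Q R) : MarkovTriple Q P R :=
  ⟨by rw [← h.eqn]; ring, h.snd_one, h.snd_neg_one, h.fst_one, h.fst_neg_one, h.trd_one,
    h.trd_neg_one⟩

theorem rotate (h : MarkovTriple P Q R) : MarkovTriple Q R P :=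
  ⟨by rw [← h.eqn]; ring, h.snd_one, h.snd_neg_one, h.trd_one, h.trd_neg_one, h.fst_one,
    h.fst_neg_one⟩

/-- The Vieta involution in the third entry. -/
theorem vieta (h : MarkovTriple P Q R) : MarkovTriple P Q (2 * P * Q - R) := by
  have key : ∀ x : ℤ, x ^ 2 = 1 → P.eval x ^ 2 = 1 → Q.eval x ^ 2 = 1 → R.eval x ^ 2 = 1 →
      (2 * P * Q - R).eval x ^ 2 = 1 := by
    intro x hx hp hq hr
    have e := congrArg (Polynomial.eval x) h.eqn
    simp only [eval_sub, eval_add, eval_mul, eval_pow, eval_ofNat, eval_X, eval_one, hx] at e ⊢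
    linear_combination 2 * e - 2 * hp - 2 * hq - hr + 4 * Q.eval x ^ 2 * hp + 4 * hq
  exact ⟨by rw [← h.eqn]; ring, h.fst_one, h.fst_neg_one, h.snd_one, h.snd_neg_one,
    key 1 (by norm_num) h.fst_one h.snd_one h.trd_one,
    key (-1) (by norm_num) h.fst_neg_one h.snd_neg_one h.trd_neg_one⟩

/-- If `P = ±1`, the left side of the equation is `1 + (Q - PR)²`, positive at `2`, where the right
side is `-8`. -/
theorem fst_natDegree_pos (h : MarkovTriple P Q R) : 1 ≤ P.natDegree := by
  rw [Nat.one_le_iff_ne_zero]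
  intro h0
  obtain ⟨c, rfl⟩ := natDegree_eq_zero.mp h0
  have hc := h.fst_one
  rw [eval_C] at hc
  have e := congrArg (Polynomial.eval 0) h.eqn
  simp only [eval_sub, eval_add, eval_mul, eval_pow, eval_ofNat, eval_X, eval_one, eval_C] at e
  have e1 := congrArg (Polynomial.eval 2) h.eqn
  simp only [eval_sub, eval_add, eval_mul, eval_pow, eval_ofNat, eval_X, eval_one, eval_C] at e1
  nlinarith [sq_nonneg (Q.eval 2 - c * R.eval 2)]

theorem trd_natDegree_pos (h : MarkovTriple P Q R) : 1 ≤ R.natDegree :=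
  h.rotate.rotate.fst_natDegree_pos

/-- The values at `±1` give `(a + b)² = (a - b)² = 1`, so `ab = 0`; this excludes other linear
polynomials as ends of the descent. -/
theorem fst_eq_of_natDegree_eq_one (h : MarkovTriple P Q R) (h1 : P.natDegree = 1) :
    P = X ∨ P = -X := by
  obtain ⟨a, b, rfl⟩ := exists_eq_X_add_C_of_natDegree_le_one h1.le
  have e1 := h.fst_one
  have e2 := h.fst_neg_one
  simp only [eval_add, eval_mul, eval_C, eval_X] at e1 e2
  have hab : a * b = 0 := by linarith
  rcases mul_eq_zero.mp hab with rfl | rfl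
  · simp at h1
  · have : a = 1 ∨ a = -1 := sq_eq_one_iff.mp (by simpa using e1)
    rcases this with rfl | rfl <;> simp

theorem fst_ne_zero (h : MarkovTriple P Q R) : P ≠ 0 := by
  rintro rfl
  simpa using h.fst_natDegree_pos

theorem natDegree_rhs_le : (1 - (X ^ 2 - 1 : ℤ[X]) ^ 2).natDegree ≤ 4 := by
  compute_degree

theorem natDegree_prod (h : MarkovTriple P Q R) :
    (2 * P * Q * R).natDegree = P.natDegree + Q.natDegree + R.natDegree := by
  have hP := h.fst_ne_zero
  have hQ := h.swap.fst_ne_zero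
  have hR := h.rotate.rotate.fst_ne_zero
  have h2 : (2 : ℤ[X]) ≠ 0 := two_ne_zero
  rw [natDegree_mul (by positivity) hR, natDegree_mul (by positivity) hQ, natDegree_mul h2 hP]
  have : (2 : ℤ[X]).natDegree = 0 := natDegree_ofNat 2
  omega

/-- The equation isolates `2PQR`, whose degree is then at most that of `R²` or of the right side. -/
theorem natDegree_add_le (h : MarkovTriple P Q R) (hPQ : P.natDegree ≤ Q.natDegree)
    (hQR : Q.natDegree ≤ R.natDegree) :
    P.natDegree + Q.natDegree + R.natDegree ≤ max (2 * R.natDegree) 4 := by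
  rw [← h.natDegree_prod]
  have : 2 * P * Q * R = P ^ 2 + Q ^ 2 + R ^ 2 - (1 - (X ^ 2 - 1) ^ 2) := by
    rw [← h.eqn]; ring
  rw [this]
  have hpow : ∀ S : ℤ[X], S.natDegree ≤ R.natDegree → (S ^ 2).natDegree ≤ 2 * R.natDegree :=
    fun S hS => natDegree_pow_le.trans (Nat.mul_le_mul_left 2 hS)
  exact natDegree_sub_le_of_le (natDegree_add_le_of_degree_le (natDegree_add_le_of_degree_le
    (hpow P (hPQ.trans hQR)) (hpow Q hQR)) (hpow R le_rfl))
    natDegree_rhs_le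

/-- `R` and its Vieta conjugate are the two roots of a quadratic, with product `P² + Q² - 1 + (X² -
1)²`. -/
theorem natDegree_add_vieta_le (h : MarkovTriple P Q R) (hPQ : P.natDegree ≤ Q.natDegree) :
    R.natDegree + (2 * P * Q - R).natDegree ≤ max (2 * Q.natDegree) 4 := by
  rw [← natDegree_mul h.rotate.rotate.fst_ne_zero h.vieta.rotate.rotate.fst_ne_zero]
  have : R * (2 * P * Q - R) = P ^ 2 + Q ^ 2 - (1 - (X ^ 2 - 1) ^ 2) := by
    rw [← h.eqn]; ring
  rw [this]
  have hpow : ∀ S : ℤ[X], S.natDegree ≤ Q.natDegree → (S ^ 2).natDegree ≤ 2 * Q.natDegree :=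
    fun S hS => natDegree_pow_le.trans (Nat.mul_le_mul_left 2 hS)
  exact natDegree_sub_le_of_le (natDegree_add_le_of_degree_le (hpow P hPQ) (hpow Q le_rfl))
    natDegree_rhs_le

/-- The entries of a triple with sorted degrees dominate `X` beyond `√2`, and the entry of largest
degree dominates the others. -/
theorem le_abs_eval_of_sorted {t : ℝ} (ht : 1 ≤ t) (ht2 : 2 ≤ t ^ 2) (n : ℕ) :
    ∀ P Q R : ℤ[X], MarkovTriple P Q R → P.natDegree ≤ Q.natDegree → Q.natDegree ≤ R.natDegree →
      P.natDegree + Q.natDegree + R.natDegree ≤ n →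
      t ≤ |aeval t P| ∧ t ≤ |aeval t Q| ∧ |aeval t P| ≤ |aeval t R| ∧
        |aeval t Q| ≤ |aeval t R| := by
  induction n with
  | zero =>
    intro P Q R h _ _ h0
    have := h.fst_natDegree_pos
    omega
  | succ n ih =>
    intro P Q R h hPQ hQR hn
    have hp := h.fst_natDegree_pos
    have hsum := h.natDegree_add_le hPQ hQR
    -- End of the descent: the degree sum is at most 4, so `P, Q = ±X`, and the equation collapses
    -- to `(R - PQ)² = 0`.
    by_cases hr : R.natDegree ≤ 2
    · have hp1 : P.natDegree = 1 := by omega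
      have hq1 : Q.natDegree = 1 := by omega
      have hP := h.fst_eq_of_natDegree_eq_one hp1
      have hQ := h.swap.fst_eq_of_natDegree_eq_one hq1
      have habs : ∀ S : ℤ[X], S = X ∨ S = -X → |aeval t S| = t := by
        rintro S (rfl | rfl) <;> simp [abs_of_nonneg (zero_le_one.trans ht)]
      have hP2 : P ^ 2 = X ^ 2 := by rcases hP with rfl | rfl <;> ring
      have hQ2 : Q ^ 2 = X ^ 2 := by rcases hQ with rfl | rfl <;> ring
      have hR : R = P * Q := by
        have : (R - P * Q) ^ 2 = 0 := by
          linear_combination h.eqn - hP2 - hQ2 + (Q ^ 2) * hP2 + X ^ 2 * hQ2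
        exact sub_eq_zero.mp (pow_eq_zero_iff (two_ne_zero)|>.mp this)
      rw [hR, map_mul, abs_mul, habs P hP, habs Q hQ]
      refine ⟨le_rfl, le_rfl, ?_, ?_⟩ <;> nlinarith
    -- Here `deg R ≥ deg P + deg Q`, so once `deg Q ≥ 2` the conjugate has degree below `deg Q`: the
    -- degree sum drops and `Q` becomes the largest entry.
    · have hv := h.natDegree_add_vieta_le hPQ
      have hr' := h.vieta.trd_natDegree_pos
      have hq2 : 2 ≤ Q.natDegree := by
        by_contra hq
        have : R.natDegree ≤ 2 := by
          have e : R = 2 * P * Q - (2 * P * Q - R) := by ring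
          have h2P : (2 * P).natDegree ≤ P.natDegree := natDegree_C_mul_le 2 P
          have hPQ2 : (2 * P * Q).natDegree ≤ 2 := natDegree_mul_le.trans (by omega)
          calc R.natDegree = (2 * P * Q - (2 * P * Q - R)).natDegree := by rw [← e]
            _ ≤ max 2 2 := natDegree_sub_le_of_le hPQ2 (by omega)
            _ = 2 := max_self 2
        exact hr this
      have hv' := h.vieta
      obtain ⟨R', hR'⟩ : ∃ R', R' = 2 * P * Q - R := ⟨_, rfl⟩
      rw [← hR'] at hv hr' hv'
      have hQ' : t ≤ |aeval t P| ∧ |aeval t P| ≤ |aeval t Q| ∧ |aeval t R'| ≤ |aeval t Q| := by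
        rcases le_total P.natDegree R'.natDegree with hle | hle
        · have := ih P R' Q hv'.swap.rotate hle (by omega) (by omega)
          exact ⟨this.1, this.2.2.1, this.2.2.2⟩
        · have := ih R' P Q hv'.rotate.rotate hle hPQ (by omega)
          exact ⟨this.2.1, this.2.2.2, this.2.2.1⟩
      obtain ⟨h1, h2, h3⟩ := hQ'
      have e : aeval t R = 2 * (aeval t P * aeval t Q) - aeval t R' := by
        simp only [hR', map_sub, map_mul, map_ofNat]; ring
      have h4 : |aeval t Q| ≤ |aeval t R| := by
        have h5 : 2 * (|aeval t P| * |aeval t Q|) - |aeval t R'| ≤ |aeval t R| := by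
          rw [e, ← abs_mul, ← abs_two (α := ℝ), ← abs_mul, abs_two]
          exact abs_sub_abs_le_abs_sub _ _
        -- `|R| ≥ 2|P||Q| - |R'| ≥ 2|Q| - |Q|`, from `|P| ≥ 1` and `|R'| ≤ |Q|`.
        nlinarith [mul_le_mul_of_nonneg_right (ht.trans h1) (abs_nonneg (aeval t Q))]
      exact ⟨h1, h1.trans h2, h2.trans h4, h4⟩

theorem le_abs_eval {t : ℝ} (ht : 1 ≤ t) (ht2 : 2 ≤ t ^ 2) (h : MarkovTriple P Q R) :
    t ≤ |aeval t P| := by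
  have key := le_abs_eval_of_sorted ht ht2
  rcases le_total P.natDegree Q.natDegree with h1 | h1 <;>
  rcases le_total Q.natDegree R.natDegree with h2 | h2 <;>
  rcases le_total P.natDegree R.natDegree with h3 | h3
  · exact (key _ P Q R h h1 h2 le_rfl).1
  · exact (key _ P Q R h h1 h2 le_rfl).1
  · exact (key _ P R Q h.swap.rotate h3 h2 le_rfl).1
  · have := key _ R P Q h.rotate.rotate h3 h1 le_rfl
    exact this.2.1
  · have := key _ Q P R h.swap h1 h3 le_rfl
    exact this.2.1
  · have := key _ Q R P h.rotate h2 h3 le_rfl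
    exact this.2.1.trans this.2.2.2
  · have := key _ R Q P h.swap.rotate.rotate h2 h1 le_rfl
    exact this.1.trans this.2.2.1
  · have := key _ R Q P h.swap.rotate.rotate h2 h1 le_rfl
    exact this.1.trans this.2.2.1

end MarkovTriple

end Jorgensen

/-! ### The generic quaternion representation and generating pairs of `F₂` -/

namespace Jorgensen

open Polynomial

noncomputable section

section Quaternion

open scoped Quaternion

variable {R : Type*} [CommRing R] {d : R}

/-- The reduced norm of the quaternion algebra with `i² = j² = d`. -/
def qnorm (q : ℍ[R, d, 0, d]) : R :=
  q.re ^ 2 - d * q.imI ^ 2 - d * q.imJ ^ 2 + d ^ 2 * q.imK ^ 2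

theorem qnorm_mul (p q : ℍ[R, d, 0, d]) : qnorm (p * q) = qnorm p * qnorm q := by
  simp only [qnorm, QuaternionAlgebra.re_mul, QuaternionAlgebra.imI_mul,
    QuaternionAlgebra.imJ_mul, QuaternionAlgebra.imK_mul]
  ring

theorem qnorm_one : qnorm (1 : ℍ[R, d, 0, d]) = 1 := by simp [qnorm]

theorem mul_star_eq_qnorm (q : ℍ[R, d, 0, d]) : q * star q = ((qnorm q : R) : ℍ[R, d, 0, d]) := by
  ext <;> simp <;> (try simp only [qnorm]) <;> ring

/-- At norm one the right side is four times the Markov expression `1 - P² - Q² - R² + 2PQR` in the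
real parts. -/
theorem qnorm_commutator (p q : ℍ[R, d, 0, d]) :
    qnorm (p * q - q * p) = 4 * (qnorm p * qnorm q - p.re ^ 2 * qnorm q - q.re ^ 2 * qnorm p
      - (p * q).re ^ 2 + 2 * p.re * q.re * (p * q).re) := by
  simp only [qnorm, QuaternionAlgebra.re_mul, QuaternionAlgebra.imI_mul,
    QuaternionAlgebra.imJ_mul, QuaternionAlgebra.imK_mul, QuaternionAlgebra.re_sub,
    QuaternionAlgebra.imI_sub, QuaternionAlgebra.imJ_sub, QuaternionAlgebra.imK_sub]
  ring

/-- The commutator is twice a cross product of imaginary parts, which makes `4d²` a factor for every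
pair. -/
theorem qnorm_commutator_eq (p q : ℍ[R, d, 0, d]) :
    qnorm (p * q - q * p) = 4 * d ^ 2 * ((p.imI * q.imJ - p.imJ * q.imI) ^ 2
      - d * (p.imJ * q.imK - p.imK * q.imJ) ^ 2 - d * (p.imK * q.imI - p.imI * q.imK) ^ 2) := by
  simp only [qnorm, QuaternionAlgebra.re_mul, QuaternionAlgebra.imI_mul,
    QuaternionAlgebra.imJ_mul, QuaternionAlgebra.imK_mul, QuaternionAlgebra.re_sub,
    QuaternionAlgebra.imI_sub, QuaternionAlgebra.imJ_sub, QuaternionAlgebra.imK_sub]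
  ring

/-- The element `a₀ + a₁ p + a₂ q + a₃ p q`. -/
def comb (p q : ℍ[R, d, 0, d]) (a : Fin 4 → R) : ℍ[R, d, 0, d] :=
  a 0 • 1 + a 1 • p + a 2 • q + a 3 • (p * q)

/-- Expand bilinearly, with `[p, pq] = p[p, q]` and `[q, pq] = -[p, q]q = -(star q)[p, q]`. -/
theorem commutator_comb (p q : ℍ[R, d, 0, d]) (a b : Fin 4 → R) :
    comb p q a * comb p q b - comb p q b * comb p q a =
      ((a 1 * b 2 - a 2 * b 1) • 1 + (a 1 * b 3 - a 3 * b 1) • p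
        - (a 2 * b 3 - a 3 * b 2) • star q) * (p * q - q * p) := by
  ext <;> simp [comb] <;> ring

theorem qnorm_commutator_comb_dvd (p q : ℍ[R, d, 0, d]) (a b : Fin 4 → R) :
    qnorm (p * q - q * p) ∣
      qnorm (comb p q a * comb p q b - comb p q b * comb p q a) := by
  rw [commutator_comb, qnorm_mul]
  exact Dvd.intro_left _ rfl

theorem mul_self_eq (p : ℍ[R, d, 0, d]) (hp : qnorm p = 1) :
    p * p = (2 * p.re) • p - 1 := by
  have h := mul_star_eq_qnorm p
  have hs : star p = (2 * p.re) • (1 : ℍ[R, d, 0, d]) - p := by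
    ext <;> simp ; ring
  rw [hs, hp, QuaternionAlgebra.coe_one, mul_sub, mul_smul_comm, mul_one] at h
  rw [← h]; abel

/-- With `right_mul_comb`: the span of `1, p, q, pq` is stable under left multiplication by `p` and
by `q`, so it contains every word in them. -/
theorem left_mul_comb (p q : ℍ[R, d, 0, d]) (hp : qnorm p = 1) (a : Fin 4 → R) :
    ∃ b, p * comb p q a = comb p q b := by
  refine ⟨![-a 1, a 0 + 2 * p.re * a 1, -a 3, a 2 + 2 * p.re * a 3], ?_⟩
  have h := mul_self_eq p hp
  simp only [comb, mul_add, mul_smul_comm, ← mul_assoc, h, sub_mul, one_mul, mul_one,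
    smul_mul_assoc]
  simp only [Matrix.cons_val]
  module

theorem right_mul_comb (p q : ℍ[R, d, 0, d]) (hq : qnorm q = 1)
    (a : Fin 4 → R) : ∃ b, q * comb p q a = comb p q b := by
  have hqq := mul_self_eq q hq
  -- Polarised Cayley–Hamilton.
  have hqp : q * p = (2 * (p * q).re - 4 * p.re * q.re) • 1 + (2 * q.re) • p
      + (2 * p.re) • q - p * q := by
    ext <;> simp <;> ring
  refine ⟨![a 1 * (2 * (p * q).re - 4 * p.re * q.re) - a 2 - a 3 * (2 * p.re),
    a 1 * (2 * q.re) + a 3,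
    a 0 + a 1 * (2 * p.re) + a 2 * (2 * q.re) + a 3 * (2 * (p * q).re), -a 1], ?_⟩
  have hqpq : q * (p * q) = (2 * (p * q).re) • q + p - (2 * p.re) • 1 := by
    rw [← mul_assoc, hqp]
    simp only [sub_mul, add_mul, smul_mul_assoc, one_mul, mul_assoc p, hqq, mul_sub,
      mul_smul_comm, mul_one]
    module
  simp only [comb, mul_add, mul_smul_comm, mul_one, hqp, hqq, hqpq]
  simp only [Matrix.cons_val]
  module

/-- The specialisation at a square root `m` of `t² - 1` of the generic quaternion algebra. -/
def spec (t m : ℝ) (hm : m ^ 2 = t ^ 2 - 1) :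
    ℍ[ℤ[X], X ^ 2 - 1, 0, X ^ 2 - 1] →* Matrix (Fin 2) (Fin 2) ℂ where
  toFun q := !![(aeval t q.re : ℝ) + Complex.I * m ^ 2 * (aeval t q.imK : ℝ),
      m * ((aeval t q.imJ : ℝ) + Complex.I * (aeval t q.imI : ℝ));
      m * ((aeval t q.imJ : ℝ) - Complex.I * (aeval t q.imI : ℝ)),
      (aeval t q.re : ℝ) - Complex.I * m ^ 2 * (aeval t q.imK : ℝ)]
  map_one' := by simp [Matrix.one_fin_two]
  map_mul' p q := by
    have hm' : (t : ℂ) ^ 2 - 1 = (m : ℂ) ^ 2 := by exact_mod_cast hm.symm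
    have hI := Complex.I_sq
    ext i j
    fin_cases i <;> fin_cases j <;>
      simp [Matrix.mul_apply, hm'] <;> ring_nf <;> simp only [hI] <;> ring

theorem trace_spec (t m : ℝ) (hm : m ^ 2 = t ^ 2 - 1) (q : ℍ[ℤ[X], X ^ 2 - 1, 0, X ^ 2 - 1]) :
    (spec t m hm q).trace = ((2 * aeval t q.re : ℝ) : ℂ) := by
  simp [spec, Matrix.trace_fin_two]
  ring

/-- The generic quaternion of norm one with trace `2 X` and imaginary part `v`, `v² = X² - 1`. -/
def genUnit (v w : ℤ) (h : v ^ 2 + w ^ 2 = 1) : ℍ[ℤ[X], X ^ 2 - 1, 0, X ^ 2 - 1]ˣ where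
  val := ⟨X, C v, C w, 0⟩
  inv := ⟨X, -C v, -C w, 0⟩
  val_inv := by
    have h' : (C v : ℤ[X]) ^ 2 + C w ^ 2 = 1 := by rw [← C_pow, ← C_pow, ← C_add, h, C_1]
    ext1
    · simp only [QuaternionAlgebra.re_mul, QuaternionAlgebra.re_one]
      linear_combination (-X ^ 2 + 1) * h'
    all_goals simp; try ring
  inv_val := by
    have h' : (C v : ℤ[X]) ^ 2 + C w ^ 2 = 1 := by rw [← C_pow, ← C_pow, ← C_add, h, C_1]
    ext1
    · simp only [QuaternionAlgebra.re_mul, QuaternionAlgebra.re_one]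
      linear_combination (-X ^ 2 + 1) * h'
    all_goals simp; try ring

/-- The generic representation of `F₂`, specialising to all the `ρ_θ`. -/
def genRep : F₂ →* ℍ[ℤ[X], X ^ 2 - 1, 0, X ^ 2 - 1]ˣ :=
  FreeGroup.lift ![genUnit 1 0 (by norm_num), genUnit 0 1 (by norm_num)]

theorem val_genRep_genA :
    (genRep genA : ℍ[ℤ[X], X ^ 2 - 1, 0, X ^ 2 - 1]) = ⟨X, 1, 0, 0⟩ := by
  simp [genRep, genA, genUnit]

theorem val_genRep_genB :
    (genRep genB : ℍ[ℤ[X], X ^ 2 - 1, 0, X ^ 2 - 1]) = ⟨X, 0, 1, 0⟩ := by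
  simp [genRep, genB, genUnit]

theorem F₂_induction {p : F₂ → Prop} (one : p 1) (of : ∀ i, p (FreeGroup.of i))
    (inv : ∀ x, p x → p x⁻¹) (mul : ∀ x y, p x → p y → p (x * y)) (w : F₂) : p w :=
  FreeGroup.induction_on w one of (fun _ h => inv _ h) mul

theorem qnorm_genRep (w : F₂) :
    qnorm (genRep w : ℍ[ℤ[X], X ^ 2 - 1, 0, X ^ 2 - 1]) = 1 := by
  induction w using F₂_induction with
  | one => simpa using qnorm_one
  | of i =>
    fin_cases i
    · exact (congrArg qnorm val_genRep_genA).trans (by simp [qnorm])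
    · exact (congrArg qnorm val_genRep_genB).trans (by simp [qnorm])
  | inv x hx =>
    have h := qnorm_mul (genRep x : ℍ[ℤ[X], X ^ 2 - 1, 0, X ^ 2 - 1]) (genRep x⁻¹ : _)
    rw [← Units.val_mul, ← map_mul, mul_inv_cancel, map_one, Units.val_one, qnorm_one, hx,
      one_mul] at h
    exact h.symm
  | mul x y hx hy => rw [map_mul, Units.val_mul, qnorm_mul, hx, hy, one_mul]

theorem val_genRep_inv (w : F₂) :
    (genRep w⁻¹ : ℍ[ℤ[X], X ^ 2 - 1, 0, X ^ 2 - 1]) =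
      (2 * (genRep w).val.re) • 1 - (genRep w).val := by
  rw [map_inv, Units.inv_eq_of_mul_eq_one_right]
  have h := mul_self_eq _ (qnorm_genRep w)
  rw [mul_sub, mul_smul_comm, mul_one, h]
  abel

theorem exists_comb_of_closure_eq_top {x y : F₂} (h : Subgroup.closure {x, y} = ⊤) (w : F₂) :
    ∃ a, (genRep w : ℍ[ℤ[X], X ^ 2 - 1, 0, X ^ 2 - 1]) = comb (genRep x).val (genRep y).val a := by
  have hw : w ∈ Subgroup.closure {x, y} := h ▸ Subgroup.mem_top w
  have hgen : ∀ z ∈ ({x, y} : Set F₂), ∀ a, ∃ b, (genRep z).val *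
      comb (genRep x).val (genRep y).val a = comb (genRep x).val (genRep y).val b := by
    rintro z (rfl | rfl) a
    · exact left_mul_comb _ _ (qnorm_genRep _) a
    · exact right_mul_comb _ _ (qnorm_genRep _) a
  induction hw using Subgroup.closure_induction_left with
  | one => exact ⟨![1, 0, 0, 0], by simp [comb]⟩
  | mul_left z hz v _ ih =>
    obtain ⟨a, ha⟩ := ih
    rw [map_mul, Units.val_mul, ha]
    exact hgen z hz a
  | inv_mul_cancel z hz v _ ih =>
    obtain ⟨a, ha⟩ := ih
    obtain ⟨b, hb⟩ := hgen z hz a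
    -- At norm one the inverse is the trace minus the element.
    refine ⟨(2 * (genRep z).val.re) • a - b, ?_⟩
    rw [map_mul, Units.val_mul, ha, val_genRep_inv, sub_mul, hb, smul_mul_assoc, one_mul]
    simp only [comb, Pi.sub_apply, Pi.smul_apply, smul_eq_mul]
    module

/-- Generating pairs of `F₂` have the same commutator norm as the standard one. -/
theorem qnorm_commutator_of_closure_eq_top {x y : F₂} (h : Subgroup.closure {x, y} = ⊤) :
    qnorm ((genRep x).val * (genRep y).val - (genRep y).val * (genRep x).val) =
      4 * (X ^ 2 - 1) ^ 2 := by
  obtain ⟨a, ha⟩ := exists_comb_of_closure_eq_top h genA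
  obtain ⟨b, hb⟩ := exists_comb_of_closure_eq_top h genB
  have hdvd := qnorm_commutator_comb_dvd (genRep x).val (genRep y).val a b
  rw [← ha, ← hb, val_genRep_genA, val_genRep_genB, qnorm_commutator_eq, qnorm_commutator_eq]
    at hdvd
  rw [qnorm_commutator_eq]
  set p := (genRep x).val
  set q := (genRep y).val
  obtain ⟨g, hg⟩ : ∃ g : ℤ[X], g = (p.imI * q.imJ - p.imJ * q.imI) ^ 2
      - (X ^ 2 - 1) * (p.imJ * q.imK - p.imK * q.imJ) ^ 2
      - (X ^ 2 - 1) * (p.imK * q.imI - p.imI * q.imK) ^ 2 := ⟨_, rfl⟩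
  rw [← hg] at hdvd ⊢
  have hd : (4 * (X ^ 2 - 1) ^ 2 : ℤ[X]) ≠ 0 := by
    intro h0
    simpa using congrArg (Polynomial.eval 0) h0
  -- The commutator norm `4d²g` of the pair divides that of `A, B`, which is `4d²`.
  have hunit : IsUnit g := by
    refine isUnit_of_dvd_one ((mul_dvd_mul_iff_left hd).mp (hdvd.trans (dvd_of_eq ?_)))
    ring
  obtain ⟨u, hu, rfl⟩ := Polynomial.isUnit_iff.mp hunit
  -- At `X = 0` one has `d = -1`, so `g` is a sum of three squares there; this rules out the unit
  -- `-1`.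
  have h0 : 0 ≤ u := by
    have := congrArg (Polynomial.eval 0) hg
    simp only [eval_sub, eval_mul, eval_pow, eval_X, eval_one, eval_C] at this
    rw [this]
    nlinarith [sq_nonneg (p.imI.eval 0 * q.imJ.eval 0 - p.imJ.eval 0 * q.imI.eval 0),
      sq_nonneg (p.imJ.eval 0 * q.imK.eval 0 - p.imK.eval 0 * q.imJ.eval 0),
      sq_nonneg (p.imK.eval 0 * q.imI.eval 0 - p.imI.eval 0 * q.imK.eval 0)]
  have h1 : u = 1 := by
    rcases Int.isUnit_iff.mp hu with rfl | rfl
    · rfl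
    · norm_num at h0
  rw [h1, C_1, mul_one]

theorem markovTriple_of_closure_eq_top {x y : F₂} (h : Subgroup.closure {x, y} = ⊤) :
    MarkovTriple (genRep x).val.re (genRep y).val.re (genRep (x * y)).val.re := by
  -- At `X = ±1` the parameter `d` vanishes and the norm is the square of the real part.
  have heval : ∀ (w : F₂) (s : ℤ), s ^ 2 = 1 → (genRep w).val.re.eval s ^ 2 = 1 := by
    intro w s hs
    have := congrArg (Polynomial.eval s) (qnorm_genRep w)
    simpa [qnorm, hs] using this
  refine ⟨?_, heval _ _ (by norm_num), heval _ _ (by norm_num), heval _ _ (by norm_num),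
    heval _ _ (by norm_num), heval _ _ (by norm_num), heval _ _ (by norm_num)⟩
  have e := qnorm_commutator (genRep x).val (genRep y).val
  rw [qnorm_commutator_of_closure_eq_top h, qnorm_genRep, qnorm_genRep] at e
  have h4 : (4 : ℤ[X]) ≠ 0 := OfNat.ofNat_ne_zero 4
  rw [map_mul, Units.val_mul]
  refine mul_left_cancel₀ h4 ?_
  linear_combination e

end Quaternion

end

end Jorgensen

/-! ### Ping-pong: injectivity and discreteness -/

namespace Jorgensen

noncomputable section

theorem sin_pos (θ : Angle) : 0 < Real.sin θ :=
  Real.sin_pos_of_pos_of_lt_pi θ.2.1 (by linarith [θ.2.2, Real.pi_pos])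

/-- The half trace `1 / sin θ` of `ρ_θ(A)` and of `ρ_θ(B)`. -/
def halfTrace (θ : Angle) : ℝ := (Real.sin θ)⁻¹

theorem cos_pos (θ : Angle) : 0 < Real.cos θ :=
  Real.cos_pos_of_mem_Ioo ⟨by linarith [θ.2.1, Real.pi_pos], by linarith [θ.2.2, Real.pi_pos]⟩

/-- This is `cos 2θ ≥ 0`; it makes the ping-pong half planes of `A^±1` disjoint from those of
`B^±1`. -/
theorem half_le_cos_sq (θ : Angle) : 1 ≤ 2 * Real.cos θ ^ 2 := by
  have h : 0 ≤ Real.cos (2 * θ) :=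
    Real.cos_nonneg_of_mem_Icc ⟨by linarith [θ.2.1, Real.pi_pos], by linarith [θ.2.2]⟩
  rw [Real.cos_two_mul] at h
  linarith

theorem halfTrace_pos (θ : Angle) : 0 < halfTrace θ := inv_pos.mpr (sin_pos θ)

theorem halfTrace_sq_mul (θ : Angle) : halfTrace θ ^ 2 * (1 - Real.cos θ ^ 2) = 1 := by
  have := (sin_pos θ).ne'
  rw [← Real.sin_sq, halfTrace]
  field_simp

theorem two_le_halfTrace_sq (θ : Angle) : 2 ≤ halfTrace θ ^ 2 := by
  nlinarith [halfTrace_sq_mul θ, half_le_cos_sq θ, sq_nonneg (halfTrace θ)]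

theorem one_le_halfTrace (θ : Angle) : 1 ≤ halfTrace θ := by
  nlinarith [two_le_halfTrace_sq θ, halfTrace_pos θ]

theorem matA_eq (θ : Angle) : (matA θ : Matrix (Fin 2) (Fin 2) ℂ) =
    !![(halfTrace θ : ℂ), Complex.I * ((Real.cos θ * halfTrace θ : ℝ) : ℂ);
      -Complex.I * ((Real.cos θ * halfTrace θ : ℝ) : ℂ), (halfTrace θ : ℂ)] := by
  ext i j
  fin_cases i <;> fin_cases j <;> simp [matA, halfTrace] <;> ring

theorem matB_eq (θ : Angle) : (matB θ : Matrix (Fin 2) (Fin 2) ℂ) =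
    !![(halfTrace θ : ℂ), ((Real.cos θ * halfTrace θ : ℝ) : ℂ);
      ((Real.cos θ * halfTrace θ : ℝ) : ℂ), (halfTrace θ : ℂ)] := by
  ext i j
  fin_cases i <;> fin_cases j <;> simp [matB, halfTrace] <;> ring

/-- The sign of a letter of a word in a free group. -/
def sgn (b : Bool) : ℝ := cond b 1 (-1)

theorem sgn_mul_self (b : Bool) : sgn b * sgn b = 1 := by cases b <;> simp [sgn]

/-- The image under `ρ_θ` of a letter. -/
def letter (θ : Angle) (x : Fin 2 × Bool) : SL(2, ℂ) :=
  cond x.2 (![matA θ, matB θ] x.1) (![matA θ, matB θ] x.1)⁻¹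

/-- Hermitian matrices with equal diagonal entries, as points of a three-dimensional Minkowski
space. -/
def hermMat (τ : ℝ) (v : Fin 2 → ℝ) : Matrix (Fin 2) (Fin 2) ℂ :=
  !![(τ : ℂ), v 1 + Complex.I * v 0; v 1 - Complex.I * v 0, (τ : ℂ)]

/-- Letters act on Minkowski space as boosts. -/
theorem letter_mul_hermMat (θ : Angle) (x : Fin 2 × Bool) (τ : ℝ) (v : Fin 2 → ℝ) :
    (letter θ x : Matrix (Fin 2) (Fin 2) ℂ) * hermMat τ v *
      (letter θ x : Matrix (Fin 2) (Fin 2) ℂ).conjTranspose =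
    hermMat (halfTrace θ ^ 2 * ((1 + Real.cos θ ^ 2) * τ + 2 * Real.cos θ * (sgn x.2 * v x.1)))
      (Function.update v x.1 (halfTrace θ ^ 2 *
        (sgn x.2 * (2 * Real.cos θ * τ) + (1 + Real.cos θ ^ 2) * v x.1))) := by
  have ht := halfTrace_sq_mul θ
  obtain ⟨i, b⟩ := x
  have hI := Complex.I_sq
  fin_cases i <;> cases b <;>
    simp only [letter, cond_true, cond_false, Fin.zero_eta, Fin.mk_one, Matrix.cons_val_zero,
      Matrix.cons_val_one, Matrix.SpecialLinearGroup.coe_inv, matA_eq, matB_eq,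
      Matrix.adjugate_fin_two_of, hermMat, sgn] <;>
    generalize halfTrace θ = t at ht ⊢ <;> generalize Real.cos θ = c at ht ⊢ <;>
    replace ht : (t : ℂ) ^ 2 * (1 - (c : ℂ) ^ 2) = 1 := by exact_mod_cast ht
  all_goals
    ext i j
    fin_cases i <;> fin_cases j <;> simp [Matrix.mul_apply, Matrix.conjTranspose_apply] <;>
    first
    | linear_combination (v 1 : ℂ) * ht + t ^ 2 * c ^ 2 * (v 1 + Complex.I * v 0) * hI
    | linear_combination (v 1 : ℂ) * ht + t ^ 2 * c ^ 2 * (v 1 - Complex.I * v 0) * hI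
    | linear_combination (Complex.I * v 0 : ℂ) * ht
    | linear_combination (-Complex.I * v 0 : ℂ) * ht
    | linear_combination (-t ^ 2 * c ^ 2 * τ + 2 * t ^ 2 * c * v 0) * hI
    | linear_combination (-t ^ 2 * c ^ 2 * τ - 2 * t ^ 2 * c * v 0) * hI
    | ring

theorem rho_mk_cons (θ : Angle) (x : Fin 2 × Bool) (L : List (Fin 2 × Bool)) :
    rho θ (FreeGroup.mk (x :: L)) = letter θ x * rho θ (FreeGroup.mk L) := by
  simp [rho, FreeGroup.lift_mk, letter]

theorem hermMat_one_zero : hermMat 1 0 = 1 := by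
  simp [hermMat, Matrix.one_fin_two]

/-- Ping-pong: a reduced word maps the base point into the half plane of its first letter. -/
theorem exists_hermMat_of_isReduced (θ : Angle) (L : List (Fin 2 × Bool))
    (hL : FreeGroup.IsReduced L) :
    ∃ (τ : ℝ) (v : Fin 2 → ℝ), 0 < τ ∧ τ ^ 2 = 1 + v 0 ^ 2 + v 1 ^ 2 ∧
      (rho θ (FreeGroup.mk L) : Matrix (Fin 2) (Fin 2) ℂ) *
        (rho θ (FreeGroup.mk L) : Matrix (Fin 2) (Fin 2) ℂ).conjTranspose = hermMat τ v ∧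
      (L = [] → v = 0) ∧ ∀ x ∈ L.head?, Real.cos θ * τ < sgn x.2 * v x.1 := by
  have hc := cos_pos θ
  have hc2 := half_le_cos_sq θ
  have ht := halfTrace_sq_mul θ
  induction L with
  | nil =>
    refine ⟨1, 0, one_pos, by simp, ?_, fun _ => rfl, by simp⟩
    rw [hermMat_one_zero, ← FreeGroup.one_eq_mk, map_one]
    simp
  | cons x L ih =>
    obtain ⟨τ, v, hτ, hτv, hM, hnil, hhead⟩ := ih (hL.infix ⟨[x], [], by simp⟩)
    -- The current point lies outside the closed half plane of the inverse of `x`, the one region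
    -- that `x` does not map into its own half plane.
    have hx : -(Real.cos θ * τ) < sgn x.2 * v x.1 := by
      rcases L with _ | ⟨y, L⟩
      · have := mul_pos hc hτ
        simpa [hnil rfl] using this
      · have hy := hhead y rfl
        have hτc := mul_pos hc hτ
        have hxy : x.1 = y.1 → x.2 = y.2 := (FreeGroup.isReduced_cons_cons.mp hL).1
        by_cases h1 : x.1 = y.1
        · rw [h1, hxy h1]; linarith
        -- For different generators, lying in both half planes would give `v 0 ² + v 1 ² > 2 cos² θ
        -- · τ² ≥ τ²`.
        · by_contra hlt
          have hsq : ∀ z : Fin 2 × Bool, v z.1 ^ 2 = (sgn z.2 * v z.1) ^ 2 := by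
            intro z
            linear_combination (-v z.1 ^ 2) * sgn_mul_self z.2
          have hsum : v 0 ^ 2 + v 1 ^ 2 = v x.1 ^ 2 + v y.1 ^ 2 := by
            rcases x with ⟨i, b⟩
            rcases y with ⟨j, b'⟩
            fin_cases i <;> fin_cases j <;> simp_all [add_comm]
          have h2 := hsq x
          have h3 := hsq y
          nlinarith
    have hpos : 0 < halfTrace θ ^ 2 := by have := halfTrace_pos θ; positivity
    have hs2 := sgn_mul_self x.2
    have hc1 : 0 < 1 - Real.cos θ ^ 2 := (mul_pos_iff_of_pos_left hpos).mp (by rw [ht]; exact one_pos)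
    refine ⟨halfTrace θ ^ 2 * ((1 + Real.cos θ ^ 2) * τ + 2 * Real.cos θ * (sgn x.2 * v x.1)),
      Function.update v x.1 (halfTrace θ ^ 2 *
        (sgn x.2 * (2 * Real.cos θ * τ) + (1 + Real.cos θ ^ 2) * v x.1)),
      mul_pos hpos (by nlinarith [mul_pos hc (neg_lt_iff_pos_add'.mp hx), mul_pos hc1 hτ]),
      ?_, ?_, by simp, ?_⟩
    · have key : ∀ u r : ℝ, τ ^ 2 = 1 + (u ^ 2 + r ^ 2) → (halfTrace θ ^ 2 *
          ((1 + Real.cos θ ^ 2) * τ + 2 * Real.cos θ * (sgn x.2 * u))) ^ 2 =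
          1 + ((halfTrace θ ^ 2 * (sgn x.2 * (2 * Real.cos θ * τ) +
            (1 + Real.cos θ ^ 2) * u)) ^ 2 + r ^ 2) := fun u r h => by
        linear_combination h + (halfTrace θ ^ 2 * (1 - Real.cos θ ^ 2) + 1) *
          (τ ^ 2 - u ^ 2) * ht +
          halfTrace θ ^ 4 * 4 * Real.cos θ ^ 2 * (u ^ 2 - τ ^ 2) * hs2
      obtain ⟨i, b⟩ := x
      fin_cases i
      · simpa [add_assoc] using key (v 0) (v 1) (by linarith)
      · simpa [add_assoc, add_comm] using key (v 1) (v 0) (by linarith)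
    · rw [rho_mk_cons, Matrix.SpecialLinearGroup.coe_mul, Matrix.conjTranspose_mul,
        ← letter_mul_hermMat, ← hM]
      simp only [mul_assoc]
    · intro z hz
      obtain rfl : x = z := by simpa using hz
      rw [Function.update_self]
      -- After the boost, the defect from the boundary of the half plane equals exactly the quantity
      -- that `hx` makes positive.
      have : sgn x.2 * (halfTrace θ ^ 2 * (sgn x.2 * (2 * Real.cos θ * τ) +
          (1 + Real.cos θ ^ 2) * v x.1)) - Real.cos θ * (halfTrace θ ^ 2 *
          ((1 + Real.cos θ ^ 2) * τ + 2 * Real.cos θ * (sgn x.2 * v x.1))) =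
          Real.cos θ * τ + sgn x.2 * v x.1 := by
        linear_combination (Real.cos θ * τ + sgn x.2 * v x.1) * ht +
          (halfTrace θ ^ 2 * 2 * Real.cos θ * τ) * hs2
      linarith

/-- Lifts differ by a sign, which cancels in `g gᴴ`; thus displacement of the base point is defined
on `PSL(2, ℂ)`. -/
theorem mul_conjTranspose_eq_of_toPSL_eq {g h : SL(2, ℂ)} (e : toPSL g = toPSL h) :
    (g : Matrix (Fin 2) (Fin 2) ℂ) * (g : Matrix (Fin 2) (Fin 2) ℂ).conjTranspose =
      (h : Matrix (Fin 2) (Fin 2) ℂ) * (h : Matrix (Fin 2) (Fin 2) ℂ).conjTranspose := by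
  obtain ⟨z, hz, rfl⟩ := (QuotientGroup.mk'_eq_mk' _).mp e
  obtain ⟨r, hr, hrz⟩ := Matrix.SpecialLinearGroup.mem_center_iff.mp hz
  have hr1 : r * star r = 1 := by
    rcases sq_eq_one_iff.mp (by simpa using hr : r ^ 2 = 1) with rfl | rfl <;> simp
  rw [Matrix.SpecialLinearGroup.coe_mul, ← hrz, Matrix.conjTranspose_mul]
  have : (Matrix.scalar (Fin 2) r) * (Matrix.scalar (Fin 2) r).conjTranspose = 1 := by
    simp [Matrix.scalar_apply, Matrix.diagonal_conjTranspose, ← Matrix.diagonal_one]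
    simpa using hr1
  rw [show ∀ a b c d : Matrix (Fin 2) (Fin 2) ℂ, a * b * (c * d) = a * (b * c) * d by
        intros; simp only [mul_assoc], this, mul_one]

/-- Nontrivial elements of a `θ`-Schottky group move the base point by a definite amount. -/
theorem cos_lt_norm_of_ne_one (θ : Angle) {w : F₂} (hw : w ≠ 1) :
    Real.cos θ < ‖((rho θ w : Matrix (Fin 2) (Fin 2) ℂ) *
      (rho θ w : Matrix (Fin 2) (Fin 2) ℂ).conjTranspose) 0 1‖ := by
  obtain ⟨τ, v, hτ, hτv, hM, -, hhead⟩ :=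
    exists_hermMat_of_isReduced θ w.toWord FreeGroup.isReduced_toWord
  rw [FreeGroup.mk_toWord] at hM
  rw [hM]
  obtain ⟨x, L, hxL⟩ := List.exists_cons_of_ne_nil (mt FreeGroup.toWord_eq_nil_iff.mp hw)
  have hx := hhead x (by simp [hxL])
  have h1 : Real.cos θ ≤ Real.cos θ * τ :=
    le_mul_of_one_le_right (cos_pos θ).le (by nlinarith [sq_nonneg (v 0), sq_nonneg (v 1)])
  have h2 : sgn x.2 * v x.1 ≤ |v x.1| := by
    cases x.2 <;> simp [sgn, le_abs_self, neg_le_abs]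
  have h3 : ∀ i, |v i| ≤ ‖(v 1 : ℂ) + Complex.I * v 0‖ := by
    intro i
    fin_cases i
    · simpa using Complex.abs_im_le_norm ((v 1 : ℂ) + Complex.I * v 0)
    · simpa using Complex.abs_re_le_norm ((v 1 : ℂ) + Complex.I * v 0)
  have h4 := h3 x.1
  simp only [hermMat, Matrix.of_apply, Matrix.cons_val_zero, Matrix.cons_val_one]
  linarith

theorem toPSL_comp_rho_injective (θ : Angle) : Function.Injective (toPSL.comp (rho θ)) := by
  rw [injective_iff_map_eq_one]
  intro w hw
  by_contra hne
  have h := cos_lt_norm_of_ne_one θ hne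
  rw [mul_conjTranspose_eq_of_toPSL_eq (h := 1) (by simpa using hw)] at h
  simp at h
  linarith [cos_pos θ]

/-- Displacement below `cos θ` is an open condition that only the identity of the group satisfies.
-/
theorem discreteTopology_schottkyGroup (θ : Angle) : DiscreteTopology (schottkyGroup θ) := by
  apply discreteTopology_of_isOpen_singleton_one
  let U : Set SL(2, ℂ) := {g | ‖((g : Matrix (Fin 2) (Fin 2) ℂ) *
    (g : Matrix (Fin 2) (Fin 2) ℂ).conjTranspose) 0 1‖ < Real.cos θ}
  have hU : IsOpen U := by
    refine isOpen_lt (Continuous.norm ?_) continuous_const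
    have hc : Continuous fun g : SL(2, ℂ) => (g : Matrix (Fin 2) (Fin 2) ℂ) :=
      continuous_subtype_val
    exact (hc.matrix_mul hc.matrix_conjTranspose).matrix_elem 0 1
  have hV : IsOpen (toPSL '' U) := QuotientGroup.isOpenMap_coe U hU
  refine ⟨toPSL '' U, hV, ?_⟩
  ext ⟨g, w, rfl⟩
  constructor
  · rintro ⟨u, hu, hug⟩
    by_contra hne
    have hw : w ≠ 1 := by
      rintro rfl
      exact hne (by simp)
    have h := cos_lt_norm_of_ne_one θ hw
    have e := mul_conjTranspose_eq_of_toPSL_eq (g := u) (h := rho θ w) hug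
    simp only [U, Set.mem_ofPred_eq, e] at hu
    exact lt_asymm h hu
  · intro h
    refine ⟨1, ?_, ?_⟩
    · simpa [U] using cos_pos θ
    · rw [map_one]
      exact (congrArg Subtype.val h).symm

end

end Jorgensen

/-! ### Infinite orbits in the interior and on the boundary -/

namespace Jorgensen

noncomputable section

theorem exists_matA_pow (θ : Angle) (n : ℕ) : ∃ ch sh : ℝ, 1 ≤ ch ∧ 0 ≤ sh ∧ (n ≠ 0 → 0 < sh) ∧
    ((matA θ ^ n : SL(2, ℂ)) : Matrix (Fin 2) (Fin 2) ℂ) =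
      !![(ch : ℂ), Complex.I * sh; -Complex.I * sh, (ch : ℂ)] ∧
    ((matB θ ^ n : SL(2, ℂ)) : Matrix (Fin 2) (Fin 2) ℂ) =
      !![(ch : ℂ), (sh : ℂ); (sh : ℂ), (ch : ℂ)] := by
  have ht := one_le_halfTrace θ
  have hm := mul_pos (cos_pos θ) (halfTrace_pos θ)
  induction n with
  | zero => exact ⟨1, 0, le_rfl, le_rfl, fun h => absurd rfl h, by simp [Matrix.one_fin_two],
      by simp [Matrix.one_fin_two]⟩
  | succ n ih =>
    obtain ⟨ch, sh, h1, h2, -, hA, hB⟩ := ih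
    have hpos : 0 < ch * (Real.cos θ * halfTrace θ) + sh * halfTrace θ := by
      have := halfTrace_pos θ
      positivity
    refine ⟨ch * halfTrace θ + sh * (Real.cos θ * halfTrace θ),
      ch * (Real.cos θ * halfTrace θ) + sh * halfTrace θ, ?_, hpos.le, fun _ => hpos, ?_, ?_⟩
    · nlinarith [mul_nonneg h2 hm.le]
    · rw [pow_succ, Matrix.SpecialLinearGroup.coe_mul, hA, matA_eq, Matrix.mul_fin_two]
      have hI := Complex.I_sq
      generalize halfTrace θ = t
      generalize Real.cos θ = c
      ext i j
      fin_cases i <;> fin_cases j <;> simp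
      · linear_combination (-sh * (c * t) : ℂ) * hI
      · ring
      · ring
      · linear_combination (-sh * (c * t) : ℂ) * hI
    · rw [pow_succ, Matrix.SpecialLinearGroup.coe_mul, hB, matB_eq, Matrix.mul_fin_two]
      generalize halfTrace θ = t
      generalize Real.cos θ = c
      ext i j
      fin_cases i <;> fin_cases j <;> simp <;> ring

theorem toPSL_matA_pow_mem (θ : Angle) (n : ℕ) : toPSL (matA θ ^ n) ∈ schottkyGroup θ :=
  ⟨genA ^ n, by simp [rho, genA]⟩

theorem toPSL_matB_pow_mem (θ : Angle) (n : ℕ) : toPSL (matB θ ^ n) ∈ schottkyGroup θ :=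
  ⟨genB ^ n, by simp [rho, genB]⟩

theorem infinite_orbit_of_pow_smul_ne {G : Subgroup PSL(2, ℂ)} {g : SL(2, ℂ)} {z : OnePoint ℂ}
    (hg : ∀ n : ℕ, toPSL (g ^ n) ∈ G)
    (hz : ∀ n : ℕ, n ≠ 0 → ((g ^ n : SL(2, ℂ)) : GL (Fin 2) ℂ) • z ≠ z) :
    {w : OnePoint ℂ | ∃ g : SL(2, ℂ), toPSL g ∈ G ∧ w = (g : GL (Fin 2) ℂ) • z}.Infinite := by
  have hinj : Function.Injective fun n : ℕ => ((g ^ n : SL(2, ℂ)) : GL (Fin 2) ℂ) • z := by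
    apply Function.Injective.of_lt_imp_ne
    rintro m n hmn h
    obtain ⟨k, rfl⟩ := Nat.exists_eq_add_of_le hmn.le
    simp only [pow_add, map_mul, mul_smul] at h
    exact hz k (by omega) (smul_left_cancel _ h).symm
  exact Set.infinite_of_injective_forall_mem hinj fun n => ⟨g ^ n, hg n, rfl⟩

open scoped OnePoint in
theorem sq_eq_of_smul_eq {g : GL (Fin 2) ℂ} {a b c : ℂ}
    (hg : (g : Matrix (Fin 2) (Fin 2) ℂ) = !![a, b; c, a]) (hc : c ≠ 0) {z : OnePoint ℂ}
    (hz : g • z = z) : ∃ x : ℂ, z = x ∧ c * x ^ 2 = b := by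
  have h00 : g 0 0 = a := by rw [hg]; rfl
  have h01 : g 0 1 = b := by rw [hg]; rfl
  have h10 : g 1 0 = c := by rw [hg]; rfl
  have h11 : g 1 1 = a := by rw [hg]; rfl
  induction z using OnePoint.rec with
  | infty => exact absurd (OnePoint.smul_infty_eq_self_iff.mp hz) (h10 ▸ hc)
  | coe x =>
    refine ⟨x, rfl, ?_⟩
    rw [OnePoint.smul_some_eq_ite, h00, h01, h10, h11] at hz
    split_ifs at hz with h0
    · exact absurd hz (OnePoint.infty_ne_coe x)
    · rw [OnePoint.coe_eq_coe, div_eq_iff h0] at hz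
      linear_combination -hz

/-- A nontrivial power of `A` fixes only points with `x² = -1`, one of `B` only points with `x² =
1`, so no point is periodic under both. -/
theorem infinite_boundary_orbit (θ : Angle) (z : OnePoint ℂ) :
    {w : OnePoint ℂ | ∃ g : SL(2, ℂ), toPSL g ∈ schottkyGroup θ ∧
      w = (g : GL (Fin 2) ℂ) • z}.Infinite := by
  by_cases hA : ∀ n : ℕ, n ≠ 0 → ((matA θ ^ n : SL(2, ℂ)) : GL (Fin 2) ℂ) • z ≠ z
  · exact infinite_orbit_of_pow_smul_ne (toPSL_matA_pow_mem θ) hA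
  · refine infinite_orbit_of_pow_smul_ne (toPSL_matB_pow_mem θ) fun k hk hB => ?_
    push Not at hA
    obtain ⟨n, hn, hA⟩ := hA
    obtain ⟨ch, sh, -, -, hsh, hAn, -⟩ := exists_matA_pow θ n
    obtain ⟨ch', sh', -, -, hsh', -, hBk⟩ := exists_matA_pow θ k
    have h0 : (sh : ℂ) ≠ 0 := by exact_mod_cast (hsh hn).ne'
    have h0' : (sh' : ℂ) ≠ 0 := by exact_mod_cast (hsh' hk).ne'
    obtain ⟨x, rfl, hx⟩ := sq_eq_of_smul_eq (by simpa using hAn)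
      (mul_ne_zero (neg_ne_zero.mpr Complex.I_ne_zero) h0) hA
    obtain ⟨y, hxy, hy⟩ := sq_eq_of_smul_eq (by simpa using hBk) h0' hB
    obtain rfl : x = y := OnePoint.coe_injective hxy
    have hx1 : x ^ 2 = 1 := mul_left_cancel₀ h0' (by rw [hy, mul_one])
    have h2 : (2 : ℂ) * (Complex.I * sh) = 0 := by
      linear_combination (-Complex.I * sh) * hx1 - hx
    simp [h0] at h2

/-- `ρ_θ(A)` is Hermitian with eigenvector `v = (1, -i)` and eigenvalue `l > 1`, so each step
multiplies `v* Q v > 0` by `l²`. -/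
theorem infinite_interior_orbit (θ : Angle) (P : Matrix (Fin 2) (Fin 2) ℂ) (hP : P.PosDef) :
    {Q : Matrix (Fin 2) (Fin 2) ℂ | ∃ g : SL(2, ℂ), toPSL g ∈ schottkyGroup θ ∧
      Q = (g : Matrix (Fin 2) (Fin 2) ℂ) * P *
        (g : Matrix (Fin 2) (Fin 2) ℂ).conjTranspose}.Infinite := by
  let v : Fin 2 → ℂ := ![1, -Complex.I]
  let l : ℝ := halfTrace θ + Real.cos θ * halfTrace θ
  have hl : 1 < l := by
    have := one_le_halfTrace θ
    have := mul_pos (cos_pos θ) (halfTrace_pos θ)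
    simp only [l]; linarith
  let M : Matrix (Fin 2) (Fin 2) ℂ := matA θ
  have hM : M.conjTranspose = M := by
    simp only [M, matA_eq]
    ext i j
    fin_cases i <;> fin_cases j <;> simp [Matrix.conjTranspose_apply, - Complex.ofReal_cos]
  have hMv : M.mulVec v = (l : ℂ) • v := by
    have hI := Complex.I_sq
    simp only [M, matA_eq, v, l]
    ext i
    fin_cases i <;> simp [Matrix.mulVec, dotProduct]
    · linear_combination (-(Complex.cos θ * halfTrace θ)) * hI
    · ring
  have hMnv : ∀ n : ℕ, (M ^ n).mulVec v = ((l : ℂ) ^ n) • v := by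
    intro n
    induction n with
    | zero => simp
    | succ n ih => rw [pow_succ, ← Matrix.mulVec_mulVec, hMv, Matrix.mulVec_smul, ih, smul_smul,
        pow_succ']
  have hv : v ≠ 0 := fun h => by simpa [v] using congrFun h 0
  have hform : ∀ n : ℕ, star v ⬝ᵥ (M ^ n * P * (M ^ n).conjTranspose).mulVec v =
      ((l : ℂ) ^ n) ^ 2 * (star v ⬝ᵥ P.mulVec v) := by
    intro n
    have e : (M ^ n).conjTranspose = M ^ n := by rw [Matrix.conjTranspose_pow, hM]
    have e2 : Matrix.vecMul (star v) (M ^ n) = ((l : ℂ) ^ n) • star v := by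
      have := congrArg star (hMnv n)
      rw [Matrix.star_mulVec, e] at this
      rw [this]
      simp
    rw [e, ← Matrix.mulVec_mulVec, ← Matrix.mulVec_mulVec, hMnv, Matrix.dotProduct_mulVec, e2,
      Matrix.mulVec_smul, smul_dotProduct, dotProduct_smul]
    simp only [smul_eq_mul]
    ring
  have hpos := hP.dotProduct_mulVec_pos hv
  have hinj : Function.Injective fun n : ℕ => M ^ n * P * (M ^ n).conjTranspose := by
    intro m n h
    have e := congrArg (fun Q : Matrix (Fin 2) (Fin 2) ℂ => star v ⬝ᵥ Q.mulVec v) h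
    simp only [hform] at e
    have e' := mul_right_cancel₀ hpos.ne' e
    have e2 : l ^ (m * 2) = l ^ (n * 2) := by
      rw [pow_mul, pow_mul]
      exact_mod_cast e'
    have := pow_right_injective₀ (zero_lt_one.trans hl) hl.ne' e2
    omega
  refine Set.infinite_of_injective_forall_mem hinj fun n => ⟨matA θ ^ n, toPSL_matA_pow_mem θ n, ?_⟩
  simp [M]

theorem nonElementary_schottkyGroup (θ : Angle) : NonElementary (schottkyGroup θ) :=
  ⟨fun P hP _ => infinite_interior_orbit θ P hP, infinite_boundary_orbit θ⟩

end

end Jorgensen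

/-! ### Computation of the Jørgensen number, rank, and range of values -/

namespace Jorgensen

noncomputable section

theorem sq_cos_mul_halfTrace (θ : Angle) :
    (Real.cos θ * halfTrace θ) ^ 2 = halfTrace θ ^ 2 - 1 := by
  linear_combination -halfTrace_sq_mul θ

theorem spec_genRep (θ : Angle) (w : F₂) :
    spec (halfTrace θ) (Real.cos θ * halfTrace θ) (sq_cos_mul_halfTrace θ) (genRep w).val =
      rho θ w := by
  let coeHom : SL(2, ℂ) →* Matrix (Fin 2) (Fin 2) ℂ :=
    ⟨⟨fun g => g, Matrix.SpecialLinearGroup.coe_one⟩, Matrix.SpecialLinearGroup.coe_mul⟩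
  have h : ((spec (halfTrace θ) (Real.cos θ * halfTrace θ) (sq_cos_mul_halfTrace θ)).comp
      (Units.coeHom _)).comp genRep = coeHom.comp (rho θ) := by
    apply FreeGroup.ext_hom
    intro i
    fin_cases i
    · have e := val_genRep_genA
      simp only [genA] at e
      simp only [Fin.zero_eta, MonoidHom.comp_apply, Units.coeHom_apply, e]
      simp only [rho, FreeGroup.lift_apply_of, Matrix.cons_val_zero]
      refine Eq.trans ?_ (matA_eq θ).symm
      simp [spec]
      ring
    · have e := val_genRep_genB
      simp only [genB] at e
      simp only [Fin.mk_one, MonoidHom.comp_apply, Units.coeHom_apply, e]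
      simp only [rho, FreeGroup.lift_apply_of, Matrix.cons_val_one]
      refine Eq.trans ?_ (matB_eq θ).symm
      simp [spec]
  exact DFunLike.congr_fun h w

theorem trace_rho (θ : Angle) (w : F₂) :
    (rho θ w : Matrix (Fin 2) (Fin 2) ℂ).trace =
      ((2 * Polynomial.aeval (halfTrace θ) (genRep w).val.re : ℝ) : ℂ) := by
  rw [← spec_genRep, trace_spec]

theorem trace_commutator (g h : SL(2, ℂ)) :
    ((g * h * g⁻¹ * h⁻¹ : SL(2, ℂ)) : Matrix (Fin 2) (Fin 2) ℂ).trace =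
      (g : Matrix (Fin 2) (Fin 2) ℂ).trace ^ 2 + (h : Matrix (Fin 2) (Fin 2) ℂ).trace ^ 2 +
      ((g * h : SL(2, ℂ)) : Matrix (Fin 2) (Fin 2) ℂ).trace ^ 2 -
      (g : Matrix (Fin 2) (Fin 2) ℂ).trace * (h : Matrix (Fin 2) (Fin 2) ℂ).trace *
        ((g * h : SL(2, ℂ)) : Matrix (Fin 2) (Fin 2) ℂ).trace - 2 := by
  have hg := g.det_coe
  have hh := h.det_coe
  rw [Matrix.det_fin_two] at hg hh
  simp only [Matrix.SpecialLinearGroup.coe_mul, Matrix.SpecialLinearGroup.coe_inv,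
    Matrix.adjugate_fin_two, Matrix.trace_fin_two,
    Matrix.mul_apply, Fin.sum_univ_two, Matrix.of_apply, Matrix.cons_val', Matrix.cons_val_zero,
    Matrix.cons_val_one, Matrix.cons_val_fin_one]
  generalize g 0 0 = a at *
  generalize g 0 1 = b at *
  generalize g 1 0 = c at *
  generalize g 1 1 = d at *
  generalize h 0 0 = p at *
  generalize h 0 1 = q at *
  generalize h 1 0 = r at *
  generalize h 1 1 = s at *
  linear_combination ((p + s) ^ 2 - 2 * (p * s - q * r)) * hg + ((a + d) ^ 2 - 2) * hh

/-- The Jørgensen number of the image of a generating pair of `F₂`. -/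
theorem pairNumber_of_closure_eq_top (θ : Angle) {x y : F₂} (h : Subgroup.closure {x, y} = ⊤) :
    pairNumber (toPSL (rho θ x)) (toPSL (rho θ y)) =
      4 * (Polynomial.aeval (halfTrace θ) (genRep x).val.re ^ 2 - 1) +
        4 * (halfTrace θ ^ 2 - 1) ^ 2 := by
  have hM := markovTriple_of_closure_eq_top h
  have hP := hM.le_abs_eval (one_le_halfTrace θ) (two_le_halfTrace_sq θ)
  have e := congrArg (Polynomial.aeval (halfTrace θ)) hM.eqn
  simp only [map_sub, map_add, map_mul, map_pow, map_ofNat, map_one, Polynomial.aeval_X] at e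
  rw [← map_mul genRep] at e
  rw [pairNumber_toPSL, pairNumberSL, trace_commutator, ← map_mul, trace_rho, trace_rho, trace_rho]
  have hP2 : 1 ≤ Polynomial.aeval (halfTrace θ) (genRep x).val.re ^ 2 := by
    rw [← sq_abs]
    nlinarith [one_le_halfTrace θ]
  generalize Polynomial.aeval (halfTrace θ) (genRep x).val.re = P at *
  generalize Polynomial.aeval (halfTrace θ) (genRep y).val.re = Q at *
  generalize Polynomial.aeval (halfTrace θ) (genRep (x * y)).val.re = R at *
  have e1 : ((2 * P : ℝ) : ℂ) ^ 2 - 4 = ((4 * (P ^ 2 - 1) : ℝ) : ℂ) := by push_cast; ring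
  -- The Markov equation at `t` makes the commutator term independent of the pair.
  have e2 : ((2 * P : ℝ) : ℂ) ^ 2 + ((2 * Q : ℝ) : ℂ) ^ 2 + ((2 * R : ℝ) : ℂ) ^ 2 -
      ((2 * P : ℝ) : ℂ) * ((2 * Q : ℝ) : ℂ) * ((2 * R : ℝ) : ℂ) - 2 - 2 =
      ((-(4 * (halfTrace θ ^ 2 - 1) ^ 2) : ℝ) : ℂ) := by
    norm_cast
    linear_combination 4 * e
  rw [e1, e2, Complex.norm_real, Complex.norm_real, norm_neg, Real.norm_of_nonneg (by linarith),
    Real.norm_of_nonneg (by positivity)]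

theorem closure_genA_genB : Subgroup.closure {genA, genB} = ⊤ := by
  rw [← FreeGroup.closure_range_of]
  congr 1
  ext z
  simp [genA, genB, Fin.exists_fin_two, eq_comm]

theorem pairNumber_genA_genB (θ : Angle) :
    pairNumber (toPSL (rho θ genA)) (toPSL (rho θ genB)) =
      4 * (halfTrace θ ^ 2 - 1) + 4 * (halfTrace θ ^ 2 - 1) ^ 2 := by
  rw [pairNumber_of_closure_eq_top θ closure_genA_genB, val_genRep_genA, Polynomial.aeval_X]

theorem pairNumber_genA_genB_eq (θ : Angle) :
    pairNumber (toPSL (rho θ genA)) (toPSL (rho θ genB)) =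
      4 * Real.cos θ ^ 2 / Real.sin θ ^ 4 := by
  have h := (sin_pos θ).ne'
  rw [pairNumber_genA_genB, Real.cos_sq', halfTrace]
  field_simp
  ring

theorem closure_toPSL_eq_schottkyGroup_iff (θ : Angle) (x y : F₂) :
    Subgroup.closure {toPSL (rho θ x), toPSL (rho θ y)} = schottkyGroup θ ↔
      Subgroup.closure {x, y} = ⊤ := by
  have e : Subgroup.closure {toPSL (rho θ x), toPSL (rho θ y)} =
      (Subgroup.closure {x, y}).map (toPSL.comp (rho θ)) := by
    rw [MonoidHom.map_closure, Set.image_pair]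
    rfl
  rw [e, schottkyGroup, MonoidHom.range_eq_map]
  exact (Subgroup.map_injective (toPSL_comp_rho_injective θ)).eq_iff

theorem number_schottkyGroup (θ : Angle) :
    number (schottkyGroup θ) = pairNumber (toPSL (rho θ genA)) (toPSL (rho θ genB)) := by
  refine IsLeast.csInf_eq ⟨⟨_, _, (closure_toPSL_eq_schottkyGroup_iff θ genA genB).mpr
    closure_genA_genB, rfl⟩, ?_⟩
  rintro _ ⟨X, Y, hXY, rfl⟩
  have hX : X ∈ schottkyGroup θ := hXY ▸ Subgroup.subset_closure (by simp)
  have hY : Y ∈ schottkyGroup θ := hXY ▸ Subgroup.subset_closure (by simp)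
  obtain ⟨x, rfl⟩ := hX
  obtain ⟨y, rfl⟩ := hY
  have hxy := (closure_toPSL_eq_schottkyGroup_iff θ x y).mp hXY
  have hP := (markovTriple_of_closure_eq_top hxy).le_abs_eval (one_le_halfTrace θ)
    (two_le_halfTrace_sq θ)
  have hP2 : halfTrace θ ^ 2 ≤ Polynomial.aeval (halfTrace θ) (genRep x).val.re ^ 2 := by
    rw [← sq_abs (Polynomial.aeval (halfTrace θ) (genRep x).val.re)]
    exact pow_le_pow_left₀ (halfTrace_pos θ).le hP 2
  have e := pairNumber_of_closure_eq_top θ hxy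
  rw [pairNumber_genA_genB]
  simp only [MonoidHom.comp_apply]
  linarith

theorem genA_mul_genB_ne : genA * genB ≠ genB * genA := by
  rw [genA, genB]
  decide

/-- The group is isomorphic to `F₂`, which is not commutative and so is not generated by at most one
element. -/
theorem hasRankTwo_schottkyGroup (θ : Angle) : HasRankTwo (schottkyGroup θ) := by
  have hfg : Group.FG F₂ := Group.fg_iff.mpr ⟨{genA, genB}, closure_genA_genB, by simp⟩
  have hrange : Group.FG (schottkyGroup θ) := by
    rw [schottkyGroup]
    infer_instance
  refine ⟨hrange, ?_⟩
  have e : F₂ ≃* schottkyGroup θ := MonoidHom.ofInjective (toPSL_comp_rho_injective θ)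
  rw [← Group.rank_congr e]
  apply le_antisymm
  · refine (Group.rank_le (S := {genA, genB}) (by simpa using closure_genA_genB)).trans ?_
    exact Finset.card_le_two
  · by_contra hlt
    obtain ⟨S, hS, hcl⟩ := Group.rank_spec (G := F₂)
    have hS1 : S.card ≤ 1 := by omega
    have hcomm : IsMulCommutative (Subgroup.closure (S : Set F₂)) := by
      refine Subgroup.isMulCommutative_closure fun x hx y hy => ?_
      rw [Finset.card_le_one.mp hS1 x hx y hy]
    rw [hcl] at hcomm
    have := hcomm.is_comm.comm ⟨genA, Subgroup.mem_top _⟩ ⟨genB, Subgroup.mem_top _⟩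
    exact genA_mul_genB_ne (congrArg Subtype.val this)

theorem tendsto_number_schottkyGroup :
    Filter.Tendsto (fun θ : Angle => number (schottkyGroup θ))
      (Filter.comap (fun θ : Angle => (θ : ℝ)) (nhds 0)) Filter.atTop := by
  have h0 : Filter.Tendsto (fun θ : Angle => (θ : ℝ))
      (Filter.comap (fun θ : Angle => (θ : ℝ)) (nhds 0)) (nhdsWithin 0 (Set.Ioi 0)) :=
    tendsto_nhdsWithin_iff.mpr ⟨Filter.tendsto_comap, Filter.Eventually.of_forall fun θ => θ.2.1⟩
  -- Compare with `1/θ ≤ 1/sin θ = t ≤ 4t²(t² - 1)`.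
  refine Filter.tendsto_atTop_mono (fun θ => ?_) (tendsto_inv_nhdsGT_zero.comp h0)
  have hs := sin_pos θ
  have hθ := θ.2.1
  have h1 : (θ : ℝ)⁻¹ ≤ halfTrace θ := inv_anti₀ hs (Real.sin_lt hθ).le
  have h2 := two_le_halfTrace_sq θ
  have h3 := one_le_halfTrace θ
  rw [number_schottkyGroup, pairNumber_genA_genB]
  simp only [Function.comp_apply]
  nlinarith [sq_nonneg (halfTrace θ ^ 2 - 1)]

theorem exists_number_schottkyGroup_eq (r : ℝ) (hr : 8 ≤ r) :
    ∃ θ : Angle, number (schottkyGroup θ) = r := by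
  -- The positive root of `4u(u - 1) = r`, with `u = t²`; `r ≥ 8` amounts to `u ≥ 2`, that is to `θ
  -- ≤ π/4`.
  set u : ℝ := (1 + √(1 + r)) / 2 with hu
  have hsq : √(1 + r) ^ 2 = 1 + r := Real.sq_sqrt (by linarith)
  have h3 : 3 ≤ √(1 + r) := Real.le_sqrt_of_sq_le (by linarith)
  have hu2 : 2 ≤ u := by rw [hu]; linarith
  have hpos : 0 < √u := Real.sqrt_pos.mpr (by linarith)
  have huu : √u ^ 2 = u := Real.sq_sqrt (by linarith)
  have h1 : (√u)⁻¹ ≤ √2 / 2 := by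
    have : (√u)⁻¹ ≤ (√2)⁻¹ := inv_anti₀ (by positivity) (Real.sqrt_le_sqrt hu2)
    refine this.trans (le_of_eq ?_)
    have := Real.sq_sqrt (zero_le_two (α := ℝ))
    field_simp
    linarith
  have h2 : √2 / 2 ≤ 1 := by
    nlinarith [Real.sq_sqrt (zero_le_two (α := ℝ)), Real.sqrt_nonneg 2]
  let θ : Angle := ⟨Real.arcsin (√u)⁻¹, Real.arcsin_pos.mpr (inv_pos.mpr hpos), by
    rw [Real.arcsin_le_iff_le_sin' ⟨by linarith [Real.pi_pos], by linarith [Real.pi_pos]⟩,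
      Real.sin_pi_div_four]
    exact h1⟩
  have ht : halfTrace θ = √u := by
    rw [halfTrace]
    simp only [θ]
    rw [Real.sin_arcsin (by linarith [inv_pos.mpr hpos]) (h1.trans h2), inv_inv]
  refine ⟨θ, ?_⟩
  rw [number_schottkyGroup, pairNumber_genA_genB, ht, huu, hu]
  linear_combination hsq

theorem number_schottkyGroup_pi_div_four (θ : Angle) (hθ : (θ : ℝ) = Real.pi / 4) :
    number (schottkyGroup θ) = 8 := by
  have h2 : √2 ^ 2 = 2 := Real.sq_sqrt (zero_le_two (α := ℝ))
  have h : halfTrace θ ^ 2 = 2 := by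
    rw [halfTrace, hθ, Real.sin_pi_div_four, inv_pow, div_pow, h2]
    norm_num
  rw [number_schottkyGroup, pairNumber_genA_genB, h]
  norm_num

end

end Jorgensen

theorem mainTheorem4 :
    (∀ θ : Jorgensen.Angle,
      DiscreteTopology (Jorgensen.schottkyGroup θ) ∧
      Jorgensen.NonElementary (Jorgensen.schottkyGroup θ) ∧
      Jorgensen.HasRankTwo (Jorgensen.schottkyGroup θ) ∧
      Jorgensen.number (Jorgensen.schottkyGroup θ) =
        Jorgensen.pairNumber (Jorgensen.toPSL (Jorgensen.rho θ Jorgensen.genA))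
          (Jorgensen.toPSL (Jorgensen.rho θ Jorgensen.genB)) ∧
      Jorgensen.pairNumber (Jorgensen.toPSL (Jorgensen.rho θ Jorgensen.genA))
          (Jorgensen.toPSL (Jorgensen.rho θ Jorgensen.genB)) =
        4 * Real.cos θ ^ 2 / Real.sin θ ^ 4) ∧
    (∀ θ : Jorgensen.Angle, (θ : ℝ) = Real.pi / 4 →
      Jorgensen.number (Jorgensen.schottkyGroup θ) = 8) ∧
    Filter.Tendsto (fun θ : Jorgensen.Angle => Jorgensen.number (Jorgensen.schottkyGroup θ))
      (Filter.comap (fun θ : Jorgensen.Angle => (θ : ℝ)) (nhds 0)) Filter.atTop ∧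
    (∀ r : ℝ, 8 ≤ r →
      ∃ θ : Jorgensen.Angle, Jorgensen.number (Jorgensen.schottkyGroup θ) = r) :=
  ⟨fun θ => ⟨Jorgensen.discreteTopology_schottkyGroup θ, Jorgensen.nonElementary_schottkyGroup θ,
    Jorgensen.hasRankTwo_schottkyGroup θ, Jorgensen.number_schottkyGroup θ,
    Jorgensen.pairNumber_genA_genB_eq θ⟩,
    Jorgensen.number_schottkyGroup_pi_div_four, Jorgensen.tendsto_number_schottkyGroup,
    Jorgensen.exists_number_schottkyGroup_eq⟩
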